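/- **Setting.** A finite-horizon two-player zero-sum partially observable stochastic game (zs-POSG) consists of finite sets $S$ of states, $A^1,A^2$ (non-empty) of actions and $Z^1,Z^2$ of observations, probabilities $P^{z^1,z^2}_{a^1,a^2}(s'\mid s)$ of moving to $s'$ and observing $(z^1,z^2)$ when $(a^1,a^2)$ is played in $s$, a reward $r(s,a^1,a^2)\in\mathbb R$, a horizon $H\in\mathbb N$, a discount factor $\gamma\in[0,1)$ and an initial belief $b_0$. Player 1 maximizes and player 2 minimizes. Let $\Theta^i_\tau=(A^i\times Z^i)^\tau$ be the set of private action-observation histories of player $i$ at time $\tau$. An occupancy state $o_\tau$ is a probability distribution on $S\times\Theta^1_\tau\times\Theta^2_\tau$. A (behavioral) decision rule $\beta^i_\tau$ maps each $\theta^i\in\Theta^i_\tau$ to a distribution on $A^i$; a behavioral strategy from $\tau$ on is a sequence $\beta^i_{\tau:H-1}=(\beta^i_\tau,\dots,\beta^i_{H-1})$ of decision rules. Put $$r(o_\tau,\beta^1_\tau,\beta^2_\tau)=\sum_{s,\theta^1,\theta^2}o_\tau(s,\theta^1,\theta^2)\sum_{a^1,a^2}\beta^1_\tau(\theta^1,a^1)\,\beta^2_\tau(\theta^2,a^2)\,r(s,a^1,a^2),$$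 and let $T(o_\tau,\beta^1_\tau,\beta^2_\tau)$ be the occupancy state at time $\tau+1$ given by $$T(o_\tau,\beta_\tau)\bigl(s',(\theta^1,a^1,z^1),(\theta^2,a^2,z^2)\bigr)=\beta^1_\tau(\theta^1,a^1)\,\beta^2_\tau(\theta^2,a^2)\sum_s P^{z^1,z^2}_{a^1,a^2}(s'\mid s)\,o_\tau(s,\theta^1,\theta^2).$$ For a profile $\beta_{\tau:H-1}=(\beta^1_{\tau:H-1},\beta^2_{\tau:H-1})$ let $V_\tau(o_\tau,\beta^1_{\tau:H-1},\beta^2_{\tau:H-1})=\sum_{t=\tau}^{H-1}\gamma^{t-\tau}r(o_t,\beta_t)$, where $o_{t+1}=T(o_t,\beta_t)$, be the expected discounted return; so $V_H=0$. A Nash equilibrium strategy profile (NES) of the subgame at $o_\tau$ is a profile from which neither player gains, in terms of $V_\tau(o_\tau,\cdot,\cdot)$, by changing their own strategy alone, and $V^*_\tau(o_\tau)$ is the value of $V_\tau(o_\tau,\cdot,\cdot)$ at an NES. The local one-step game at $o_\tau$ has the payoff $$Q^*_\tau(o_\tau,\beta^1_\tau,\beta^2_\tau)=r(o_\tau,\beta^1_\tau,\beta^2_\tau)+\gamma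 V^*_{\tau+1}\bigl(T(o_\tau,\beta^1_\tau,\beta^2_\tau)\bigr),$$ in which player 1 picks the decision rule $\beta^1_\tau$ to maximize and player 2 picks $\beta^2_\tau$ to minimize. **Theorem.** Let $0\le\tau\le H-1$ and let $o_\tau$ be any occupancy state at time $\tau$. 1. The subgame at $o_\tau$ has an NES, and all its NESs have the same value, $V^*_\tau(o_\tau)$. 2. The maximin and minimax values of the local game are both equal to this Nash-equilibrium value, all maxima and minima being attained: $$\max_{\beta^1_\tau}\min_{\beta^2_\tau}Q^*_\tau(o_\tau,\beta^1_\tau,\beta^2_\tau)=\min_{\beta^2_\tau}\max_{\beta^1_\tau}Q^*_\tau(o_\tau,\beta^1_\tau,\beta^2_\tau)=V^*_\tau(o_\tau).$$ 3. These values correspond to NESs. If $\beta^1_\tau$ attains the maximin value and $\beta^2_\tau$ attains the minimax value, then $(\beta^1_\tau,\beta^2_\tau)$ is a Nash equilibrium of the local game, and there is an NES of the subgame at $T(o_\tau,\beta^1_\tau,\beta^2_\tau)$ such that $(\beta^1_\tau,\beta^2_\tau)$ followed by it is an NES of the subgame at $o_\tau$. Conversely, if $(\beta^1_{\tau:H-1},\beta^2_{\tau:H-1})$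 is an NES of the subgame at $o_\tau$, then $\beta^1_\tau$ attains the maximin value and $\beta^2_\tau$ attains the minimax value of the local game. -/

import Mathlib

/-- A finite-horizon two-player zero-sum partially observable stochastic game with (finite) state
space `S`, action spaces `A₁`, `A₂` and observation spaces `Z₁`, `Z₂`. -/
structure ZSPOSG (S A₁ A₂ Z₁ Z₂ : Type*)
    [Fintype S] [Fintype A₁] [Fintype A₂] [Fintype Z₁] [Fintype Z₂] where
  /-- `P s a₁ a₂` is the joint law of the next state and of the two observations. -/
  P : S → A₁ → A₂ → stdSimplex ℝ (S × Z₁ × Z₂)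
  /-- The reward, which player 1 maximizes and player 2 minimizes. -/
  r : S → A₁ → A₂ → ℝ
  /-- The (finite) horizon: decisions are made at the times `0, …, H - 1`. -/
  H : ℕ
  /-- The discount factor. -/
  γ : ℝ
  γ_nonneg : 0 ≤ γ
  γ_lt_one : γ < 1
  /-- The initial belief. -/
  b₀ : stdSimplex ℝ S

/-- Private action-observation histories of length `τ`. -/
abbrev History (A Z : Type*) (τ : ℕ) : Type _ := Fin τ → A × Z

/-- Behavioral decision rules at time `τ`: maps from private histories of length `τ` to
distributions over private actions. -/
abbrev DecisionRule (A Z : Type*) [Fintype A] (τ : ℕ) : Type _ :=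
  History A Z τ → stdSimplex ℝ A

/-- Behavioral strategies: one decision rule for each time step. In a game with horizon `H`, a
strategy for the subgame that starts at time `τ` consists of the entries at the times
`τ, …, H - 1`; the values of that subgame do not depend on the other entries. -/
abbrev Strategy (A Z : Type*) [Fintype A] : Type _ := (t : ℕ) → DecisionRule A Z t

/-- Occupancy states at time `τ`: probability distributions over triples made of a state and of the
two private histories of length `τ`. -/
abbrev Occupancy (S A₁ A₂ Z₁ Z₂ : Type*)
    [Fintype S] [Fintype A₁] [Fintype A₂] [Fintype Z₁] [Fintype Z₂] (τ : ℕ) : Type _ :=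
  stdSimplex ℝ (S × History A₁ Z₁ τ × History A₂ Z₂ τ)

section GameValues

variable {X Y : Type*}

/-- `v = max_x min_y f x y`, where all the minima and the maximum are attained. -/
def IsMaximinValue (f : X → Y → ℝ) (v : ℝ) : Prop :=
  ∃ m : X → ℝ, (∀ x, IsLeast (Set.range fun y => f x y) (m x)) ∧ IsGreatest (Set.range m) v

/-- `v = min_y max_x f x y`, where all the maxima and the minimum are attained. -/
def IsMinimaxValue (f : X → Y → ℝ) (v : ℝ) : Prop :=
  ∃ M : Y → ℝ, (∀ y, IsGreatest (Set.range fun x => f x y) (M y)) ∧ IsLeast (Set.range M) v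

/-- `x` attains the outer maximum in `max_x min_y f x y`. -/
def IsMaximinChoice (f : X → Y → ℝ) (x : X) : Prop :=
  ∃ v, IsMaximinValue f v ∧ IsLeast (Set.range fun y => f x y) v

/-- `y` attains the outer minimum in `min_y max_x f x y`. -/
def IsMinimaxChoice (f : X → Y → ℝ) (y : Y) : Prop :=
  ∃ v, IsMinimaxValue f v ∧ IsGreatest (Set.range fun x => f x y) v

/-- `(x, y)` is a Nash equilibrium of the zero-sum game in which the first player picks `x` to
maximize `f x y` and the second player picks `y` to minimize it. -/
def IsNash (f : X → Y → ℝ) (x : X) (y : Y) : Prop :=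
  (∀ x', f x' y ≤ f x y) ∧ (∀ y', f x y ≤ f x y')

end GameValues

namespace ZSPOSG

variable {S A₁ A₂ Z₁ Z₂ : Type*}
  [Fintype S] [Fintype A₁] [Fintype A₂] [Fintype Z₁] [Fintype Z₂]

/-- The weight that the next occupancy state gives to
`(s', (θ₁, a₁, z₁), (θ₂, a₂, z₂))`, namely
`β₁(θ₁, a₁) β₂(θ₂, a₂) ∑ s, P(s', z₁, z₂ | s, a₁, a₂) o(s, θ₁, θ₂)`. A history of length `τ + 1`
is split into its first `τ` entries (`Fin.init`) and its last action-observation pair. -/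
def nextWeight (G : ZSPOSG S A₁ A₂ Z₁ Z₂) {τ : ℕ} (o : Occupancy S A₁ A₂ Z₁ Z₂ τ)
    (β₁ : DecisionRule A₁ Z₁ τ) (β₂ : DecisionRule A₂ Z₂ τ)
    (x : S × History A₁ Z₁ (τ + 1) × History A₂ Z₂ (τ + 1)) : ℝ :=
  (β₁ (Fin.init x.2.1)).1 (x.2.1 (Fin.last τ)).1 *
    (β₂ (Fin.init x.2.2)).1 (x.2.2 (Fin.last τ)).1 *
    ∑ s, (G.P s (x.2.1 (Fin.last τ)).1 (x.2.2 (Fin.last τ)).1).1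
        (x.1, (x.2.1 (Fin.last τ)).2, (x.2.2 (Fin.last τ)).2) *
      o.1 (s, Fin.init x.2.1, Fin.init x.2.2)

theorem sum_history_succ {A Z : Type*} [Fintype A] [Fintype Z] {τ : ℕ}
    (f : History A Z (τ + 1) → ℝ) :
    ∑ θ, f θ = ∑ θ : History A Z τ, ∑ a : A, ∑ z : Z,
      f (Fin.snoc (α := fun _ => A × Z) θ (a, z)) := by
  rw [← (Fin.snocEquiv fun _ : Fin (τ + 1) => A × Z).sum_comp, Fintype.sum_prod_type,
    Finset.sum_comm]
  refine Finset.sum_congr rfl fun θ _ => ?_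
  rw [Fintype.sum_prod_type]
  rfl

theorem sum_triple {X Y Z : Type*} [Fintype X] [Fintype Y] [Fintype Z] (f : X × Y × Z → ℝ) :
    ∑ x, f x = ∑ y, ∑ z, ∑ x, f (x, y, z) := by
  rw [Fintype.sum_prod_type, Finset.sum_comm, Fintype.sum_prod_type]

theorem nextWeight_mem (G : ZSPOSG S A₁ A₂ Z₁ Z₂) {τ : ℕ} (o : Occupancy S A₁ A₂ Z₁ Z₂ τ)
    (β₁ : DecisionRule A₁ Z₁ τ) (β₂ : DecisionRule A₂ Z₂ τ) :
    G.nextWeight o β₁ β₂ ∈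
      stdSimplex ℝ (S × History A₁ Z₁ (τ + 1) × History A₂ Z₂ (τ + 1)) := by
  refine ⟨fun x => ?_, ?_⟩
  · exact mul_nonneg (mul_nonneg ((β₁ _).2.1 _) ((β₂ _).2.1 _))
      (Finset.sum_nonneg fun s _ => mul_nonneg ((G.P _ _ _).2.1 _) (o.2.1 _))
  · have hP : ∀ s a₁ a₂, ∑ z₁, ∑ z₂, ∑ s', (G.P s a₁ a₂).1 (s', z₁, z₂) = 1 := fun s a₁ a₂ => by
      rw [← sum_triple, (G.P s a₁ a₂).2.2]
    have hstep : ∀ θ₁ θ₂ a₁ a₂,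
        ∑ z₁, ∑ z₂, ∑ s', (β₁ θ₁).1 a₁ * (β₂ θ₂).1 a₂ *
            ∑ s, (G.P s a₁ a₂).1 (s', z₁, z₂) * o.1 (s, θ₁, θ₂) =
          (β₁ θ₁).1 a₁ * (β₂ θ₂).1 a₂ * ∑ s, o.1 (s, θ₁, θ₂) := by
      intro θ₁ θ₂ a₁ a₂
      simp only [← Finset.mul_sum]
      congr 1
      calc _ = ∑ s, ∑ z₁, ∑ z₂, ∑ s', (G.P s a₁ a₂).1 (s', z₁, z₂) * o.1 (s, θ₁, θ₂) := by
            symm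
            rw [Finset.sum_comm]
            refine Finset.sum_congr rfl fun z₁ _ => ?_
            rw [Finset.sum_comm]
            exact Finset.sum_congr rfl fun z₂ _ => Finset.sum_comm
        _ = _ := by simp only [← Finset.sum_mul, hP, one_mul]
    rw [sum_triple, sum_history_succ, ← o.2.2, sum_triple]
    refine Finset.sum_congr rfl fun θ₁ _ => ?_
    simp only [sum_history_succ (A := A₂), nextWeight, Fin.init_snoc, Fin.snoc_last]
    calc _ = ∑ θ₂, ∑ a₁, ∑ a₂, ∑ z₁, ∑ z₂, ∑ s', (β₁ θ₁).1 a₁ * (β₂ θ₂).1 a₂ *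
              ∑ s, (G.P s a₁ a₂).1 (s', z₁, z₂) * o.1 (s, θ₁, θ₂) := by
          refine ((Finset.sum_congr rfl fun a₁ _ => Finset.sum_comm).trans Finset.sum_comm).trans ?_
          exact Finset.sum_congr rfl fun θ₂ _ => Finset.sum_congr rfl fun a₁ _ => Finset.sum_comm
      _ = _ := by
          refine Finset.sum_congr rfl fun θ₂ _ => ?_
          simp only [hstep]
          simp only [← Finset.sum_mul, ← Finset.mul_sum, (β₁ θ₁).2.2, (β₂ θ₂).2.2, mul_one,
            one_mul]

/-- The transition function of the occupancy game: the next occupancy state. -/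
def T (G : ZSPOSG S A₁ A₂ Z₁ Z₂) {τ : ℕ} (o : Occupancy S A₁ A₂ Z₁ Z₂ τ)
    (β₁ : DecisionRule A₁ Z₁ τ) (β₂ : DecisionRule A₂ Z₂ τ) :
    Occupancy S A₁ A₂ Z₁ Z₂ (τ + 1) :=
  ⟨G.nextWeight o β₁ β₂, G.nextWeight_mem o β₁ β₂⟩

/-- The expected instant reward `r(o, β)` in an occupancy state under a decision rule profile. -/
def reward (G : ZSPOSG S A₁ A₂ Z₁ Z₂) {τ : ℕ} (o : Occupancy S A₁ A₂ Z₁ Z₂ τ)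
    (β₁ : DecisionRule A₁ Z₁ τ) (β₂ : DecisionRule A₂ Z₂ τ) : ℝ :=
  ∑ s, ∑ θ₁, ∑ θ₂, o.1 (s, θ₁, θ₂) *
    ∑ a₁, ∑ a₂, (β₁ θ₁).1 a₁ * (β₂ θ₂).1 a₂ * G.r s a₁ a₂

/-- The occupancy state reached from `o` (at time `τ`) after `k` further steps; it is the law of
the state and of the private histories at time `τ + k`. -/
def occupancyAfter (G : ZSPOSG S A₁ A₂ Z₁ Z₂) {τ : ℕ} (o : Occupancy S A₁ A₂ Z₁ Z₂ τ)
    (β₁ : Strategy A₁ Z₁) (β₂ : Strategy A₂ Z₂) :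
    (k : ℕ) → Occupancy S A₁ A₂ Z₁ Z₂ (τ + k)
  | 0 => o
  | k + 1 => G.T (occupancyAfter G o β₁ β₂ k) (β₁ (τ + k)) (β₂ (τ + k))

/-- The value `V_τ(o, β₁, β₂) = E[∑_{τ ≤ t < H} γ^(t - τ) R_t]` of a profile in the subgame
at `o`. It is `0` for `τ ≥ H`. -/
noncomputable def V (G : ZSPOSG S A₁ A₂ Z₁ Z₂) {τ : ℕ} (o : Occupancy S A₁ A₂ Z₁ Z₂ τ)
    (β₁ : Strategy A₁ Z₁) (β₂ : Strategy A₂ Z₂) : ℝ :=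
  ∑ k ∈ Finset.range (G.H - τ),
    G.γ ^ k * G.reward (G.occupancyAfter o β₁ β₂ k) (β₁ (τ + k)) (β₂ (τ + k))

/-- `(β₁, β₂)` is a Nash equilibrium strategy profile of the subgame at `o`. -/
def IsNES (G : ZSPOSG S A₁ A₂ Z₁ Z₂) {τ : ℕ} (o : Occupancy S A₁ A₂ Z₁ Z₂ τ)
    (β₁ : Strategy A₁ Z₁) (β₂ : Strategy A₂ Z₂) : Prop :=
  IsNash (G.V o) β₁ β₂

open Classical in
/-- The Nash-equilibrium value of the subgame at `o`: the value of a Nash equilibrium strategy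
profile (all of them have the same value). The default `0` stands for the case that there is none. -/
noncomputable def Vstar (G : ZSPOSG S A₁ A₂ Z₁ Z₂) {τ : ℕ} (o : Occupancy S A₁ A₂ Z₁ Z₂ τ) : ℝ :=
  if h : ∃ β : Strategy A₁ Z₁ × Strategy A₂ Z₂, G.IsNES o β.1 β.2 then
    G.V o h.choose.1 h.choose.2
  else 0

/-- The local one-step game at `o`. -/
noncomputable def Qstar (G : ZSPOSG S A₁ A₂ Z₁ Z₂) {τ : ℕ} (o : Occupancy S A₁ A₂ Z₁ Z₂ τ)
    (β₁ : DecisionRule A₁ Z₁ τ) (β₂ : DecisionRule A₂ Z₂ τ) : ℝ :=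
  G.reward o β₁ β₂ + G.γ * G.Vstar (G.T o β₁ β₂)

end ZSPOSG

/-! A payoff $V_\tau(o,\beta^1,\beta^2)$ is not affine in the behavioral rules, since the
probabilities chosen at successive times multiply. It is bilinear in the realization weights: the
product of a player's own action probabilities along a private history. A convex combination of two
weight systems again comes from a behavioral strategy, obtained by conditioning
(`Strategy.exists_plan_eq`). So the rows and the columns of the payoff form convex sets, strategy
spaces are compact, the payoff is continuous, and a minimax theorem (`exists_isNash_of_convex`)
gives equilibria.

Realization weights are counted from time $\tau$, so mixing two strategies with a common rule at
$\tau$ keeps that rule. Hence equilibria also exist when one player's first rule is prescribed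
(`exists_isNash_fixed_left`, `exists_isNash_fixed_right`).

This settles the local game without any convexity of $Q^*$. Once both first rules are fixed, the
next occupancy state is fixed, so $Q^*(b,c)$ is the value of the game confined to these first rules
(`isLocalGame_Qstar`). The value of the game with only $b$ prescribed is then $\min_c Q^*(b,c)$,
guaranteed by one strategy starting with $b$ (`IsLocalGame.exists_isLeast`). Maximizing over $b$
gives $V^*$, and exchanging the players gives the minimax side. -/

section GameValues

variable {X Y : Type*}

/-! ### Minimax theorem for payoffs with convex rows and columns -/

/-- A compact family of payoffs whose rows and columns form convex sets satisfies the minimax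
alternative at each level `c`. -/
theorem exists_forall_le_or_exists_forall_le [TopologicalSpace X] [CompactSpace X]
    {f : X → Y → ℝ} (hf : ∀ y, Continuous fun x => f x y) (hX : Convex ℝ (Set.range f))
    (hY : Convex ℝ (Set.range fun y x => f x y)) (hne : Nonempty Y) (c : ℝ) :
    (∃ x, ∀ y, c ≤ f x y) ∨ ∃ y, ∀ x, f x y ≤ c := by
  by_contra! ⟨h₁, h₂⟩
  -- By compactness, finitely many `y` already keep every `x` from guaranteeing `c`. The separation
  -- can then take place in a finite-dimensional space, between the payoff vectors and the orthant
  -- above `c`.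
  obtain ⟨t, ht⟩ : ∃ t : Finset Y, (Set.univ ∩ ⋂ y ∈ t, {x | c ≤ f x y}) = ∅ := by
    refine isCompact_univ.elim_finite_subfamily_closed _
      (fun y => isClosed_le continuous_const (hf y)) ?_
    ext x
    simpa using h₁ x
  have ht' : ∀ x, ∃ y ∈ t, f x y < c := fun x => by
    by_contra! h
    have : x ∈ (Set.univ ∩ ⋂ y ∈ t, {x | c ≤ f x y}) := by simpa using h
    simp [ht] at this
  let ρ : (Y → ℝ) →ₗ[ℝ] (t → ℝ) := LinearMap.funLeft ℝ ℝ (fun y : t => (y : Y))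
  have hK : Convex ℝ (Set.range fun x (y : t) => f x y) := by
    have := hX.linear_image ρ
    rwa [← Set.range_comp] at this
  have hKc : IsCompact (Set.range fun x (y : t) => f x y) :=
    isCompact_range (continuous_pi fun y => hf y)
  obtain ⟨l, u, v, hlu, huv, hlv⟩ := geometric_hahn_banach_compact_closed hK hKc
    (convex_Ici (fun _ : t => c)) isClosed_Ici (by
      refine Set.disjoint_left.2 ?_
      rintro _ ⟨x, rfl⟩ hx
      obtain ⟨y, hy, hlt⟩ := ht' x
      exact absurd (hx ⟨y, hy⟩) (not_le.2 hlt))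
  classical
  set w : t → ℝ := fun y => l (Pi.single y 1) with hw
  have hl : ∀ z : t → ℝ, l z = ∑ y, w y * z y := fun z => by
    conv_lhs => rw [← Finset.univ_sum_single z, map_sum]
    refine Finset.sum_congr rfl fun y _ => ?_
    have : Pi.single y (z y) = z y • (Pi.single y 1 : t → ℝ) := by
      rw [← Pi.single_smul]; simp
    rw [this, map_smul, smul_eq_mul, mul_comm]
  -- The functional exceeds `v` on the whole orthant; with a negative weight, moving far enough
  -- along that coordinate would bring it down to `v`.
  have hw0 : ∀ y, 0 ≤ w y := fun y => by
    by_contra! hneg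
    have hn0 : ∀ n : ℝ, 0 ≤ n → v < l (fun _ => c) + n * w y := fun n hn => by
      have := hlv ((fun _ => c) + n • Pi.single y 1) (by
        intro i
        by_cases hi : i = y
        · simpa [hi] using hn
        · simp [hi])
      simpa using this
    have h0 := hn0 (max 0 ((v - l (fun _ => c)) / w y)) (le_max_left _ _)
    have h1 : max 0 ((v - l (fun _ => c)) / w y) * w y ≤ (v - l (fun _ => c)) / w y * w y :=
      mul_le_mul_of_nonpos_right (le_max_right _ _) hneg.le
    rw [div_mul_cancel₀ _ hneg.ne] at h1
    linarith
  have hX0 : Nonempty X := (h₂ hne.some).nonempty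
  have hlt : ∀ x, ∑ y : t, w y * f x y < ∑ y : t, w y * c := fun x => by
    rw [← hl, ← hl]
    exact (hlu _ ⟨x, rfl⟩).trans (huv.trans (hlv _ (Set.mem_Ici.2 le_rfl)))
  have hW : 0 < ∑ y, w y := by
    refine lt_of_le_of_ne (Finset.sum_nonneg fun y _ => hw0 y) fun h => ?_
    have hz := (Finset.sum_eq_zero_iff_of_nonneg fun y _ => hw0 y).1 h.symm
    refine (hlt hX0.some).ne ?_
    rw [Finset.sum_eq_zero fun y hy => by rw [hz y hy, zero_mul],
      Finset.sum_eq_zero fun y hy => by rw [hz y hy, zero_mul]]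
  -- The normalized separating weights mix the columns in `t` into a single column that stays below
  -- `c`, against `h₂`.
  have hmem := hY.centerMass_mem (t := (Finset.univ : Finset t)) (w := w)
    (z := fun y x => f x y) (fun y _ => hw0 y) hW (fun y _ => ⟨(y : Y), rfl⟩)
  obtain ⟨y₀, hy₀⟩ := hmem
  obtain ⟨x, hx⟩ := h₂ y₀
  have hxy := congrFun hy₀ x
  simp only [Finset.centerMass, Pi.smul_apply, Finset.sum_apply, smul_eq_mul] at hxy
  have h3 := hlt x
  rw [← Finset.sum_mul] at h3
  rw [hxy, lt_inv_mul_iff₀ hW] at hx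
  linarith

/-- A continuous game on compact strategy spaces whose rows and columns form convex sets has a
Nash equilibrium. -/
theorem exists_isNash_of_convex [TopologicalSpace X] [CompactSpace X] [TopologicalSpace Y]
    [CompactSpace Y] [Nonempty X] [Nonempty Y] {f : X → Y → ℝ}
    (hf : Continuous fun p : X × Y => f p.1 p.2) (hX : Convex ℝ (Set.range f))
    (hY : Convex ℝ (Set.range fun y x => f x y)) : ∃ x y, IsNash f x y := by
  have hfx : ∀ x, Continuous (f x) := fun x => hf.comp (Continuous.prodMk_right x)
  have hfy : ∀ y, Continuous fun x => f x y := fun y => hf.comp (Continuous.prodMk_left y)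
  have hm : Continuous fun x => sInf (f x '' Set.univ) := isCompact_univ.continuous_sInf hf
  have hM : Continuous fun y => sSup ((fun x => f x y) '' Set.univ) :=
    isCompact_univ.continuous_sSup (hf.comp continuous_swap)
  obtain ⟨x₀, -, hx₀⟩ := isCompact_univ.exists_isMaxOn Set.univ_nonempty hm.continuousOn
  obtain ⟨y₀, -, hy₀⟩ := isCompact_univ.exists_isMinOn Set.univ_nonempty hM.continuousOn
  have hle : ∀ x y, sInf (f x '' Set.univ) ≤ f x y := fun x y =>
    csInf_le (isCompact_univ.image (hfx x)).bddBelow ⟨y, trivial, rfl⟩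
  have hge : ∀ x y, f x y ≤ sSup ((fun x => f x y) '' Set.univ) := fun x y =>
    le_csSup (isCompact_univ.image (hfy y)).bddAbove ⟨x, trivial, rfl⟩
  -- A level strictly between the two optimal guarantees would contradict the alternative.
  have key : sSup ((fun x => f x y₀) '' Set.univ) ≤ sInf (f x₀ '' Set.univ) := by
    by_contra! hlt
    obtain ⟨c, hc₁, hc₂⟩ := exists_between hlt
    rcases exists_forall_le_or_exists_forall_le hfy hX hY inferInstance c with ⟨x, hx⟩ | ⟨y, hy⟩
    · refine absurd (hx₀ (Set.mem_univ x)) (not_le.2 (hc₁.trans_le ?_))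
      exact le_csInf (Set.univ_nonempty.image _) (by rintro _ ⟨y, -, rfl⟩; exact hx y)
    · refine absurd (hy₀ (Set.mem_univ y)) (not_le.2 (lt_of_le_of_lt ?_ hc₂))
      exact csSup_le (Set.univ_nonempty.image _) (by rintro _ ⟨x, -, rfl⟩; exact hy x)
  exact ⟨x₀, y₀, fun x => (hge x y₀).trans (key.trans (hle x₀ y₀)),
    fun y => (hge x₀ y₀).trans (key.trans (hle x₀ y))⟩

/-! ### Exchange of the players, and uniqueness of values -/

theorem IsNash.neg_swap {f : X → Y → ℝ} {x : X} {y : Y} (h : IsNash f x y) :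
    IsNash (fun y x => -f x y) y x :=
  ⟨fun y' => neg_le_neg (h.2 y'), fun x' => neg_le_neg (h.1 x')⟩

theorem IsNash.value_eq {f : X → Y → ℝ} {x x' : X} {y y' : Y} (h : IsNash f x y)
    (h' : IsNash f x' y') : f x y = f x' y' :=
  le_antisymm ((h.2 y').trans (h'.1 x)) ((h'.2 y).trans (h.1 x'))

theorem isLeast_range_neg {g : X → ℝ} {v : ℝ} :
    IsLeast (Set.range fun x => -g x) v ↔ IsGreatest (Set.range g) (-v) := by
  rw [IsLeast, IsGreatest, mem_lowerBounds, mem_upperBounds, Set.forall_mem_range,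
    Set.forall_mem_range]
  simp only [Set.mem_range, neg_eq_iff_eq_neg, le_neg]

theorem isGreatest_range_neg {g : X → ℝ} {v : ℝ} :
    IsGreatest (Set.range fun x => -g x) v ↔ IsLeast (Set.range g) (-v) := by
  rw [IsLeast, IsGreatest, mem_lowerBounds, mem_upperBounds, Set.forall_mem_range,
    Set.forall_mem_range]
  simp only [Set.mem_range, neg_eq_iff_eq_neg, neg_le]

theorem isMaximinValue_neg_swap {f : X → Y → ℝ} {v : ℝ} :
    IsMaximinValue (fun y x => -f x y) v ↔ IsMinimaxValue f (-v) := by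
  constructor
  · rintro ⟨m, hm, hv⟩
    refine ⟨fun y => -m y, fun y => isLeast_range_neg.1 (hm y), ?_⟩
    rwa [← isGreatest_range_neg, funext fun y => neg_neg (m y)]
  · rintro ⟨m, hm, hv⟩
    refine ⟨fun y => -m y, fun y => isLeast_range_neg.2 ?_, isGreatest_range_neg.2 hv⟩
    rw [neg_neg]
    exact hm y

theorem isMaximinChoice_neg_swap {f : X → Y → ℝ} {y : Y} :
    IsMaximinChoice (fun y x => -f x y) y ↔ IsMinimaxChoice f y := by
  constructor
  · rintro ⟨v, hv, hy⟩
    exact ⟨-v, isMaximinValue_neg_swap.1 hv, isLeast_range_neg.1 hy⟩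
  · rintro ⟨v, hv, hy⟩
    refine ⟨-v, isMaximinValue_neg_swap.2 ?_, isLeast_range_neg.2 ?_⟩ <;> rwa [neg_neg]

theorem IsMaximinValue.unique {f : X → Y → ℝ} {v w : ℝ} (hv : IsMaximinValue f v)
    (hw : IsMaximinValue f w) : v = w := by
  obtain ⟨m, hm, hv⟩ := hv
  obtain ⟨n, hn, hw⟩ := hw
  obtain rfl : m = n := funext fun x => (hm x).unique (hn x)
  exact hv.unique hw

theorem IsMaximinChoice.le {f : X → Y → ℝ} {v : ℝ} {x : X} (hx : IsMaximinChoice f x)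
    (hv : IsMaximinValue f v) (y : Y) : v ≤ f x y := by
  obtain ⟨w, hw, hx⟩ := hx
  rw [hv.unique hw]
  exact hx.2 ⟨y, rfl⟩

/-! ### Local games -/

/-- `Q` is the local game of `f` with respect to the first moves `p` and `q`: the entry `Q b c` is
the value of `f` restricted to the strategies with first moves `b` and `c`. -/
def IsLocalGame {B C : Type*} (p : X → B) (q : Y → C) (f : X → Y → ℝ) (Q : B → C → ℝ) : Prop :=
  ∀ b c, ∃ x y, p x = b ∧ q y = c ∧
    (∀ x', p x' = b → f x' y ≤ Q b c) ∧ ∀ y', q y' = c → Q b c ≤ f x y'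

section LocalGame

variable {B C : Type*} {p : X → B} {q : Y → C} {f : X → Y → ℝ} {Q : B → C → ℝ}

theorem IsLocalGame.neg_swap (h : IsLocalGame p q f Q) :
    IsLocalGame q p (fun y x => -f x y) (fun c b => -Q b c) := fun c b => by
  obtain ⟨x, y, hx, hy, h₁, h₂⟩ := h b c
  exact ⟨y, x, hy, hx, fun y' hy' => neg_le_neg (h₂ y' hy'), fun x' hx' => neg_le_neg (h₁ x' hx')⟩

/-- If the game in which the first player has to start with `b` has a Nash equilibrium, then its
value is the guaranteed value of `b` in the local game, and some strategy that starts with `b`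
guarantees it. -/
theorem IsLocalGame.exists_isLeast (h : IsLocalGame p q f Q) {b : B}
    (hb : ∃ x y, IsNash (fun (x : {x // p x = b}) y => f x y) x y) :
    ∃ m x, p x = b ∧ IsLeast (Set.range fun c => Q b c) m ∧ ∀ y, m ≤ f x y := by
  obtain ⟨⟨x, hx⟩, y, h₁, h₂⟩ := hb
  -- The strategy `y'` holds every strategy starting with `b` down to `Q b c`, and `y` does at least
  -- as well as `y'` against `x`.
  have hlow : ∀ c, f x y ≤ Q b c := fun c => by
    obtain ⟨-, y', -, -, h', -⟩ := h b c
    exact (h₂ y').trans (h' x hx)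
  refine ⟨f x y, x, hx, ⟨⟨q y, le_antisymm ?_ (hlow _)⟩, ?_⟩, h₂⟩
  · obtain ⟨x', -, hx', -, -, h'⟩ := h b (q y)
    exact (h' y rfl).trans (h₁ ⟨x', hx'⟩)
  · rintro _ ⟨c, rfl⟩
    exact hlow c

/-- No `b` guarantees more than the equilibrium value, since `y` caps every strategy. The rule `p x`
reaches it, because `x` guarantees it against every reply, including one that holds `p x` to its
local minimum. -/
theorem IsLocalGame.isMaximin (h : IsLocalGame p q f Q)
    (hN : ∀ b, ∃ x y, IsNash (fun (x : {x // p x = b}) y => f x y) x y) {x : X} {y : Y}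
    (hxy : IsNash f x y) :
    IsMaximinValue Q (f x y) ∧ IsMaximinChoice Q (p x) := by
  choose m g hg hm hgm using fun b => h.exists_isLeast (hN b)
  have hle : ∀ b, m b ≤ f x y := fun b => (hgm b y).trans (hxy.1 _)
  have heq : m (p x) = f x y := by
    refine le_antisymm (hle _) ?_
    obtain ⟨c, hc⟩ := (hm (p x)).1
    obtain ⟨-, y', -, -, h', -⟩ := h (p x) c
    rw [← hc]
    exact (hxy.2 y').trans (h' x rfl)
  have hv : IsMaximinValue Q (f x y) :=
    ⟨m, hm, ⟨p x, heq⟩, by rintro _ ⟨b, rfl⟩; exact hle b⟩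
  exact ⟨hv, f x y, hv, heq ▸ hm (p x)⟩

theorem IsLocalGame.exists_guarantee (h : IsLocalGame p q f Q)
    (hN : ∀ b, ∃ x y, IsNash (fun (x : {x // p x = b}) y => f x y) x y)
    {v : ℝ} (hv : IsMaximinValue Q v) {b : B} (hb : IsMaximinChoice Q b) : ∃ x, p x = b ∧ ∀ y, v ≤ f x y := by
  obtain ⟨m, x, hx, hm, hxm⟩ := h.exists_isLeast (hN b)
  obtain ⟨w, hw, hb⟩ := hb
  rw [hv.unique hw, hb.unique hm]
  exact ⟨x, hx, hxm⟩

end LocalGame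

end GameValues

/-! ### Realization weights and mixing of behavioral strategies -/

section Mixing

variable {A Z : Type*} [Fintype A]

/-- The probability with which the strategy `β` contributes to the private history `θ` from
time `τ` on. -/
def Strategy.reach (τ : ℕ) (β : Strategy A Z) : (t : ℕ) → History A Z t → ℝ
  | 0, _ => 1
  | t + 1, θ => if t < τ then 1 else
      Strategy.reach τ β t (Fin.init θ) * (β t (Fin.init θ)).1 (θ (Fin.last t)).1

theorem Strategy.reach_nonneg (τ : ℕ) (β : Strategy A Z) :
    ∀ (t : ℕ) (θ : History A Z t), 0 ≤ Strategy.reach τ β t θ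
  | 0, _ => zero_le_one
  | t + 1, θ => by
    rw [Strategy.reach]
    split_ifs
    · exact zero_le_one
    · exact mul_nonneg (Strategy.reach_nonneg τ β t _) ((β t _).2.1 _)

theorem Strategy.reach_self (τ : ℕ) (β : Strategy A Z) (θ : History A Z τ) :
    Strategy.reach τ β τ θ = 1 := by
  cases τ with
  | zero => rfl
  | succ t => rw [Strategy.reach, if_pos t.lt_succ_self]

/-- The realization weight of taking the action `act` after the history `θ`. -/
def Strategy.plan (τ : ℕ) (β : Strategy A Z) (t : ℕ) (θ : History A Z t) (act : A) : ℝ :=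
  Strategy.reach τ β t θ * (β t θ).1 act

theorem Strategy.sum_plan (τ : ℕ) (β : Strategy A Z) (t : ℕ) (θ : History A Z t) :
    ∑ act, Strategy.plan τ β t θ act = Strategy.reach τ β t θ := by
  simp only [Strategy.plan, ← Finset.mul_sum]
  rw [(β t θ).2.2, mul_one]

theorem Strategy.plan_nonneg (τ : ℕ) (β : Strategy A Z) (t : ℕ) (θ : History A Z t) (act : A) :
    0 ≤ Strategy.plan τ β t θ act :=
  mul_nonneg (Strategy.reach_nonneg τ β t θ) ((β t θ).2.1 act)

/-- Behavioral strategies that coincide at time `τ` can be mixed, with the same rule at time `τ`,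
so that the realization weights are mixed linearly. -/
theorem Strategy.exists_plan_eq (τ : ℕ) (β β' : Strategy A Z) {a b : ℝ} (ha : 0 ≤ a) (hb : 0 ≤ b)
    (hab : a + b = 1) : ∃ γ : Strategy A Z, (β τ = β' τ → γ τ = β τ) ∧
      ∀ t θ act, Strategy.plan τ γ t θ act =
        a * Strategy.plan τ β t θ act + b * Strategy.plan τ β' t θ act := by
  classical
  set D : (t : ℕ) → History A Z t → ℝ := fun t θ =>
    a * Strategy.reach τ β t θ + b * Strategy.reach τ β' t θ with hD
  have hD0 : ∀ t θ, 0 ≤ D t θ := fun t θ =>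
    add_nonneg (mul_nonneg ha (Strategy.reach_nonneg ..)) (mul_nonneg hb (Strategy.reach_nonneg ..))
  -- The mixture conditioned on reaching `θ`. The default at weight zero is harmless, as both mixed
  -- realization weights vanish there.
  let γ : Strategy A Z := fun t θ => if h : D t θ = 0 then β t θ else
    ⟨fun act => (a * Strategy.plan τ β t θ act + b * Strategy.plan τ β' t θ act) / D t θ,
      fun act => div_nonneg (add_nonneg (mul_nonneg ha (Strategy.plan_nonneg ..))
        (mul_nonneg hb (Strategy.plan_nonneg ..))) (hD0 t θ), by
      rw [← Finset.sum_div, Finset.sum_add_distrib, ← Finset.mul_sum, ← Finset.mul_sum,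
        Strategy.sum_plan, Strategy.sum_plan]
      exact div_self h⟩
  have hstep : ∀ t θ act, D t θ * (γ t θ).1 act =
      a * Strategy.plan τ β t θ act + b * Strategy.plan τ β' t θ act := fun t θ act => by
    by_cases h : D t θ = 0
    · have h₁ : 0 ≤ a * Strategy.reach τ β t θ := mul_nonneg ha (Strategy.reach_nonneg ..)
      have h₂ : 0 ≤ b * Strategy.reach τ β' t θ := mul_nonneg hb (Strategy.reach_nonneg ..)
      have h₃ : a * Strategy.reach τ β t θ + b * Strategy.reach τ β' t θ = 0 := h
      have h₄ : a * Strategy.reach τ β t θ = 0 := by linarith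
      have h₅ : b * Strategy.reach τ β' t θ = 0 := by linarith
      rw [h, zero_mul, Strategy.plan, Strategy.plan, ← mul_assoc, ← mul_assoc, h₄, h₅]
      simp
    · have : γ t θ = _ := dif_neg h
      rw [this]
      exact mul_div_cancel₀ _ h
  have hreach : ∀ t θ, Strategy.reach τ γ t θ = D t θ := by
    intro t
    induction t with
    | zero => intro θ; simp [hD, Strategy.reach, hab]
    | succ t ih =>
      intro θ
      by_cases ht : t < τ
      · simp [hD, Strategy.reach, ht, hab]
      · rw [Strategy.reach, if_neg ht, ih, hstep]
        simp only [hD, Strategy.reach, if_neg ht, Strategy.plan]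
  refine ⟨γ, fun h => ?_, fun t θ act => ?_⟩
  -- At time `τ` all reach weights are `1`, so the normalizing factor is `a + b = 1`.
  · funext θ
    refine Subtype.ext (funext fun act => ?_)
    have := hstep τ θ act
    simp only [hD, Strategy.plan, Strategy.reach_self, ← h, mul_one, hab, one_mul] at this
    rw [this, ← add_mul, hab, one_mul]
  · rw [Strategy.plan, hreach, hstep]

/-- A set of strategies is closed under mixing if it contains, for any two of its members, a
strategy whose realization weights are any given convex combination of theirs. -/
def Strategy.IsMixable (τ : ℕ) (C : Set (Strategy A Z)) : Prop :=
  ∀ β ∈ C, ∀ β' ∈ C, ∀ ⦃a b : ℝ⦄, 0 ≤ a → 0 ≤ b → a + b = 1 → ∃ γ ∈ C, ∀ t θ act,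
    Strategy.plan τ γ t θ act = a * Strategy.plan τ β t θ act + b * Strategy.plan τ β' t θ act

theorem Strategy.isMixable_univ (τ : ℕ) : Strategy.IsMixable τ (Set.univ : Set (Strategy A Z)) :=
  fun β _ β' _ _ _ ha hb hab =>
    let ⟨γ, _, h⟩ := Strategy.exists_plan_eq τ β β' ha hb hab
    ⟨γ, trivial, h⟩

theorem Strategy.isMixable_fixed (τ : ℕ) (b : DecisionRule A Z τ) :
    Strategy.IsMixable τ {β : Strategy A Z | β τ = b} :=
  fun β hβ β' hβ' _ _ ha hb hab =>
    let ⟨γ, hγ, h⟩ := Strategy.exists_plan_eq τ β β' ha hb hab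
    ⟨γ, (hγ (Eq.trans hβ (Eq.symm hβ'))).trans hβ, h⟩

theorem Strategy.isClosed_fixed (τ : ℕ) (b : DecisionRule A Z τ) :
    IsClosed {β : Strategy A Z | β τ = b} :=
  isClosed_eq (_root_.continuous_apply τ) continuous_const

theorem Strategy.nonempty_fixed [Nonempty A] (τ : ℕ) (b : DecisionRule A Z τ) :
    {β : Strategy A Z | β τ = b}.Nonempty :=
  ⟨Function.update (Classical.arbitrary (Strategy A Z)) τ b, Function.update_self τ b _⟩

theorem Strategy.continuous_apply (t : ℕ) (θ : History A Z t) (act : A) :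
    Continuous fun β : Strategy A Z => (β t θ).1 act :=
  (_root_.continuous_apply act).comp (continuous_subtype_val.comp
    ((_root_.continuous_apply θ).comp (_root_.continuous_apply t)))

end Mixing

/-! ### Bilinearity, continuity and existence of equilibria -/

namespace ZSPOSG

variable {S A₁ A₂ Z₁ Z₂ : Type*}
  [Fintype S] [Fintype A₁] [Fintype A₂] [Fintype Z₁] [Fintype Z₂]

/-- The contribution of the environment to the weight of a state and two histories in the
occupancy state reached from `o` after `k` steps. -/
def natureWeight (G : ZSPOSG S A₁ A₂ Z₁ Z₂) {τ : ℕ} (o : Occupancy S A₁ A₂ Z₁ Z₂ τ) :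
    (k : ℕ) → S × History A₁ Z₁ (τ + k) × History A₂ Z₂ (τ + k) → ℝ
  | 0, x => o.1 x
  | k + 1, x => ∑ s, (G.P s (x.2.1 (Fin.last (τ + k))).1 (x.2.2 (Fin.last (τ + k))).1).1
      (x.1, (x.2.1 (Fin.last (τ + k))).2, (x.2.2 (Fin.last (τ + k))).2) *
      natureWeight G o k (s, Fin.init x.2.1, Fin.init x.2.2)

/-- Each step multiplies by action probabilities that depend only on the private histories, so they
leave the sum over hidden states. -/
theorem occupancyAfter_eq (G : ZSPOSG S A₁ A₂ Z₁ Z₂) {τ : ℕ} (o : Occupancy S A₁ A₂ Z₁ Z₂ τ)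
    (β₁ : Strategy A₁ Z₁) (β₂ : Strategy A₂ Z₂) (k : ℕ) :
    ∀ x, (G.occupancyAfter o β₁ β₂ k).1 x =
      Strategy.reach τ β₁ (τ + k) x.2.1 * Strategy.reach τ β₂ (τ + k) x.2.2 *
        G.natureWeight o k x := by
  induction k with
  | zero =>
    intro x
    have h₁ := Strategy.reach_self τ β₁ x.2.1
    have h₂ := Strategy.reach_self τ β₂ x.2.2
    change o.1 x = Strategy.reach τ β₁ τ x.2.1 * Strategy.reach τ β₂ τ x.2.2 * o.1 x
    rw [h₁, h₂, one_mul, one_mul]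
  | succ k ih =>
    intro x
    have hk : ¬ τ + k < τ := by omega
    change G.nextWeight (G.occupancyAfter o β₁ β₂ k) (β₁ (τ + k)) (β₂ (τ + k)) x =
      Strategy.reach τ β₁ (τ + k + 1) x.2.1 * Strategy.reach τ β₂ (τ + k + 1) x.2.2 * _
    rw [Strategy.reach, Strategy.reach, if_neg hk, if_neg hk, nextWeight, natureWeight]
    simp only [ih, Finset.mul_sum]
    refine Finset.sum_congr rfl fun s _ => ?_
    ring

/-- The remaining coefficient is independent of the strategies; this is the bilinearity behind both
mixing lemmas. -/
theorem V_eq_sum_plan (G : ZSPOSG S A₁ A₂ Z₁ Z₂) {τ : ℕ} (o : Occupancy S A₁ A₂ Z₁ Z₂ τ)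
    (β₁ : Strategy A₁ Z₁) (β₂ : Strategy A₂ Z₂) :
    G.V o β₁ β₂ = ∑ k ∈ Finset.range (G.H - τ), ∑ s, ∑ θ₁, ∑ θ₂, ∑ a₁, ∑ a₂,
      Strategy.plan τ β₁ (τ + k) θ₁ a₁ * Strategy.plan τ β₂ (τ + k) θ₂ a₂ *
        (G.γ ^ k * G.natureWeight o k (s, θ₁, θ₂) * G.r s a₁ a₂) := by
  simp only [V, reward, occupancyAfter_eq, Finset.mul_sum, Strategy.plan]
  refine Finset.sum_congr rfl fun k _ => Finset.sum_congr rfl fun s _ =>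
    Finset.sum_congr rfl fun θ₁ _ => Finset.sum_congr rfl fun θ₂ _ =>
    Finset.sum_congr rfl fun a₁ _ => Finset.sum_congr rfl fun a₂ _ => ?_
  ring

theorem V_mix_left (G : ZSPOSG S A₁ A₂ Z₁ Z₂) {τ : ℕ} (o : Occupancy S A₁ A₂ Z₁ Z₂ τ)
    {a b : ℝ} {β β' β'' : Strategy A₁ Z₁} (h : ∀ t θ act, Strategy.plan τ β'' t θ act =
      a * Strategy.plan τ β t θ act + b * Strategy.plan τ β' t θ act) (β₂ : Strategy A₂ Z₂) :
    G.V o β'' β₂ = a * G.V o β β₂ + b * G.V o β' β₂ := by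
  simp only [V_eq_sum_plan, h, Finset.mul_sum, ← Finset.sum_add_distrib]
  refine Finset.sum_congr rfl fun k _ => Finset.sum_congr rfl fun s _ =>
    Finset.sum_congr rfl fun θ₁ _ => Finset.sum_congr rfl fun θ₂ _ =>
    Finset.sum_congr rfl fun a₁ _ => Finset.sum_congr rfl fun a₂ _ => ?_
  ring

theorem V_mix_right (G : ZSPOSG S A₁ A₂ Z₁ Z₂) {τ : ℕ} (o : Occupancy S A₁ A₂ Z₁ Z₂ τ)
    {a b : ℝ} {β β' β'' : Strategy A₂ Z₂} (h : ∀ t θ act, Strategy.plan τ β'' t θ act =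
      a * Strategy.plan τ β t θ act + b * Strategy.plan τ β' t θ act) (β₁ : Strategy A₁ Z₁) :
    G.V o β₁ β'' = a * G.V o β₁ β + b * G.V o β₁ β' := by
  simp only [V_eq_sum_plan, h, Finset.mul_sum, ← Finset.sum_add_distrib]
  refine Finset.sum_congr rfl fun k _ => Finset.sum_congr rfl fun s _ =>
    Finset.sum_congr rfl fun θ₁ _ => Finset.sum_congr rfl fun θ₂ _ =>
    Finset.sum_congr rfl fun a₁ _ => Finset.sum_congr rfl fun a₂ _ => ?_
  ring

theorem continuous_occupancyAfter (G : ZSPOSG S A₁ A₂ Z₁ Z₂) {τ : ℕ}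
    (o : Occupancy S A₁ A₂ Z₁ Z₂ τ) (k : ℕ) :
    Continuous fun β : Strategy A₁ Z₁ × Strategy A₂ Z₂ => G.occupancyAfter o β.1 β.2 k := by
  induction k with
  | zero => exact continuous_const
  | succ k ih =>
    refine Continuous.subtype_mk (continuous_pi fun x => ?_) _
    unfold nextWeight
    have h := fun y => (continuous_apply y).comp (continuous_subtype_val.comp ih)
    have h₁ := fun θ a => (Strategy.continuous_apply (A := A₁) (Z := Z₁) (τ + k) θ a).comp
      (continuous_fst (Y := Strategy A₂ Z₂))
    have h₂ := fun θ a => (Strategy.continuous_apply (A := A₂) (Z := Z₂) (τ + k) θ a).comp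
      (continuous_snd (X := Strategy A₁ Z₁))
    exact ((h₁ _ _).mul (h₂ _ _)).mul
      (continuous_finsetSum _ fun s _ => continuous_const.mul (h _))

theorem continuous_V (G : ZSPOSG S A₁ A₂ Z₁ Z₂) {τ : ℕ} (o : Occupancy S A₁ A₂ Z₁ Z₂ τ) :
    Continuous fun β : Strategy A₁ Z₁ × Strategy A₂ Z₂ => G.V o β.1 β.2 := by
  have h : ∀ k y, Continuous fun β : Strategy A₁ Z₁ × Strategy A₂ Z₂ =>
      (G.occupancyAfter o β.1 β.2 k).1 y := fun k y =>
    (continuous_apply y).comp (continuous_subtype_val.comp (G.continuous_occupancyAfter o k))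
  have h₁ : ∀ k θ a, Continuous fun β : Strategy A₁ Z₁ × Strategy A₂ Z₂ => (β.1 (τ + k) θ).1 a :=
    fun k θ a => (Strategy.continuous_apply (τ + k) θ a).comp continuous_fst
  have h₂ : ∀ k θ a, Continuous fun β : Strategy A₁ Z₁ × Strategy A₂ Z₂ => (β.2 (τ + k) θ).1 a :=
    fun k θ a => (Strategy.continuous_apply (τ + k) θ a).comp continuous_snd
  unfold V reward
  refine continuous_finsetSum _ fun k _ => continuous_const.mul ?_
  refine continuous_finsetSum _ fun s _ => continuous_finsetSum _ fun θ₁ _ =>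
    continuous_finsetSum _ fun θ₂ _ => (h k _).mul ?_
  refine continuous_finsetSum _ fun a₁ _ => continuous_finsetSum _ fun a₂ _ => ?_
  exact ((h₁ k θ₁ a₁).mul (h₂ k θ₂ a₂)).mul continuous_const

/-- A subgame in which the players are confined to nonempty sets of strategies that are closed,
topologically and under mixing, has a Nash equilibrium. -/
theorem exists_isNash_restrict (G : ZSPOSG S A₁ A₂ Z₁ Z₂) {τ : ℕ}
    (o : Occupancy S A₁ A₂ Z₁ Z₂ τ) {C₁ : Set (Strategy A₁ Z₁)} {C₂ : Set (Strategy A₂ Z₂)}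
    (hc₁ : IsClosed C₁) (hc₂ : IsClosed C₂) (hm₁ : Strategy.IsMixable τ C₁)
    (hm₂ : Strategy.IsMixable τ C₂) (hn₁ : C₁.Nonempty) (hn₂ : C₂.Nonempty) :
    ∃ (β₁ : C₁) (β₂ : C₂), IsNash (fun (β₁ : C₁) (β₂ : C₂) => G.V o β₁ β₂) β₁ β₂ := by
  have := hn₁.to_subtype
  have := hn₂.to_subtype
  have := isCompact_iff_compactSpace.1 hc₁.isCompact
  have := isCompact_iff_compactSpace.1 hc₂.isCompact
  refine exists_isNash_of_convex ?_ ?_ ?_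
  · exact Continuous.comp (g := fun β : Strategy A₁ Z₁ × Strategy A₂ Z₂ => G.V o β.1 β.2)
      (f := fun p : C₁ × C₂ => (p.1.1, p.2.1)) (G.continuous_V o)
      ((continuous_subtype_val.comp continuous_fst).prodMk
        (continuous_subtype_val.comp continuous_snd))
  · rintro _ ⟨β, rfl⟩ _ ⟨β', rfl⟩ a b ha hb hab
    obtain ⟨β'', hβ, h⟩ := hm₁ β β.2 β' β'.2 ha hb hab
    exact ⟨⟨β'', hβ⟩, funext fun β₂ => G.V_mix_left o h β₂⟩
  · rintro _ ⟨β, rfl⟩ _ ⟨β', rfl⟩ a b ha hb hab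
    obtain ⟨β'', hβ, h⟩ := hm₂ β β.2 β' β'.2 ha hb hab
    exact ⟨⟨β'', hβ⟩, funext fun β₁ => G.V_mix_right o h β₁⟩

theorem exists_isNES [Nonempty A₁] [Nonempty A₂] (G : ZSPOSG S A₁ A₂ Z₁ Z₂) {τ : ℕ}
    (o : Occupancy S A₁ A₂ Z₁ Z₂ τ) : ∃ β₁ β₂, G.IsNES o β₁ β₂ := by
  obtain ⟨β₁, β₂, h₁, h₂⟩ := G.exists_isNash_restrict o isClosed_univ isClosed_univ
    (Strategy.isMixable_univ τ) (Strategy.isMixable_univ τ) Set.univ_nonempty Set.univ_nonempty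
  exact ⟨β₁, β₂, fun β => h₁ ⟨β, trivial⟩, fun β => h₂ ⟨β, trivial⟩⟩

theorem exists_isNash_fixed_left [Nonempty A₁] [Nonempty A₂] (G : ZSPOSG S A₁ A₂ Z₁ Z₂) {τ : ℕ}
    (o : Occupancy S A₁ A₂ Z₁ Z₂ τ) (b : DecisionRule A₁ Z₁ τ) :
    ∃ β₁ β₂, IsNash (fun (β₁ : {β₁ : Strategy A₁ Z₁ // β₁ τ = b}) β₂ => G.V o β₁ β₂) β₁ β₂ := by
  obtain ⟨β₁, β₂, h₁, h₂⟩ := G.exists_isNash_restrict o (Strategy.isClosed_fixed τ b)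
    isClosed_univ (Strategy.isMixable_fixed τ b) (Strategy.isMixable_univ τ)
    (Strategy.nonempty_fixed τ b) Set.univ_nonempty
  exact ⟨β₁, β₂, h₁, fun β => h₂ ⟨β, trivial⟩⟩

theorem exists_isNash_fixed_right [Nonempty A₁] [Nonempty A₂] (G : ZSPOSG S A₁ A₂ Z₁ Z₂) {τ : ℕ}
    (o : Occupancy S A₁ A₂ Z₁ Z₂ τ) (b : DecisionRule A₂ Z₂ τ) :
    ∃ β₁ β₂, IsNash (fun β₁ (β₂ : {β₂ : Strategy A₂ Z₂ // β₂ τ = b}) => G.V o β₁ β₂) β₁ β₂ := by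
  obtain ⟨β₁, β₂, h₁, h₂⟩ := G.exists_isNash_restrict o isClosed_univ
    (Strategy.isClosed_fixed τ b) (Strategy.isMixable_univ τ) (Strategy.isMixable_fixed τ b)
    Set.univ_nonempty (Strategy.nonempty_fixed τ b)
  exact ⟨β₁, β₂, fun β => h₁ ⟨β, trivial⟩, h₂⟩

theorem IsNES.V_eq_Vstar {G : ZSPOSG S A₁ A₂ Z₁ Z₂} {τ : ℕ} {o : Occupancy S A₁ A₂ Z₁ Z₂ τ}
    {β₁ : Strategy A₁ Z₁} {β₂ : Strategy A₂ Z₂} (h : G.IsNES o β₁ β₂) :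
    G.V o β₁ β₂ = G.Vstar o := by
  have hex : ∃ β : Strategy A₁ Z₁ × Strategy A₂ Z₂, G.IsNES o β.1 β.2 := ⟨(β₁, β₂), h⟩
  rw [Vstar, dif_pos hex]
  exact IsNash.value_eq h hex.choose_spec

/-! ### One-step decomposition of the value -/

/-- The sigma type absorbs the mismatch between the time indices `τ + 1 + k` and `τ + (k + 1)`. -/
theorem occupancyAfter_T (G : ZSPOSG S A₁ A₂ Z₁ Z₂) {τ : ℕ} (o : Occupancy S A₁ A₂ Z₁ Z₂ τ)
    (β₁ : Strategy A₁ Z₁) (β₂ : Strategy A₂ Z₂) (k : ℕ) :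
    (⟨τ + 1 + k, G.occupancyAfter (G.T o (β₁ τ) (β₂ τ)) β₁ β₂ k⟩ :
      Σ t, Occupancy S A₁ A₂ Z₁ Z₂ t) = ⟨τ + (k + 1), G.occupancyAfter o β₁ β₂ (k + 1)⟩ := by
  induction k with
  | zero => rfl
  | succ k ih =>
    exact congrArg (fun p : Σ t, Occupancy S A₁ A₂ Z₁ Z₂ t =>
      (⟨p.1 + 1, G.T p.2 (β₁ p.1) (β₂ p.1)⟩ : Σ t, Occupancy S A₁ A₂ Z₁ Z₂ t)) ih

theorem V_eq_reward_add (G : ZSPOSG S A₁ A₂ Z₁ Z₂) {τ : ℕ} (hτ : τ < G.H)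
    (o : Occupancy S A₁ A₂ Z₁ Z₂ τ) (β₁ : Strategy A₁ Z₁) (β₂ : Strategy A₂ Z₂) :
    G.V o β₁ β₂ = G.reward o (β₁ τ) (β₂ τ) + G.γ * G.V (G.T o (β₁ τ) (β₂ τ)) β₁ β₂ := by
  rw [V, V, show G.H - τ = G.H - (τ + 1) + 1 by omega, Finset.sum_range_succ', add_comm,
    Finset.mul_sum]
  congr 1
  · rw [pow_zero, one_mul]
    rfl
  · refine Finset.sum_congr rfl fun k _ => ?_
    rw [pow_succ', mul_assoc]
    congr 2
    exact (congrArg (fun p : Σ t, Occupancy S A₁ A₂ Z₁ Z₂ t =>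
      G.reward p.2 (β₁ p.1) (β₂ p.1)) (G.occupancyAfter_T o β₁ β₂ k)).symm

theorem V_congr (G : ZSPOSG S A₁ A₂ Z₁ Z₂) {τ : ℕ} (o : Occupancy S A₁ A₂ Z₁ Z₂ τ)
    {β₁ β₁' : Strategy A₁ Z₁} {β₂ β₂' : Strategy A₂ Z₂} (h₁ : ∀ t, τ ≤ t → β₁ t = β₁' t)
    (h₂ : ∀ t, τ ≤ t → β₂ t = β₂' t) : G.V o β₁ β₂ = G.V o β₁' β₂' := by
  have ho : ∀ k, G.occupancyAfter o β₁ β₂ k = G.occupancyAfter o β₁' β₂' k := fun k => by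
    induction k with
    | zero => rfl
    | succ k ih =>
      rw [occupancyAfter, occupancyAfter, ih, h₁ _ (Nat.le_add_right τ k),
        h₂ _ (Nat.le_add_right τ k)]
  refine Finset.sum_congr rfl fun k _ => ?_
  rw [ho, h₁ _ (Nat.le_add_right τ k), h₂ _ (Nat.le_add_right τ k)]

theorem V_update (G : ZSPOSG S A₁ A₂ Z₁ Z₂) {τ : ℕ} (o : Occupancy S A₁ A₂ Z₁ Z₂ (τ + 1))
    (β₁ : Strategy A₁ Z₁) (β₂ : Strategy A₂ Z₂) (b₁ : DecisionRule A₁ Z₁ τ)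
    (b₂ : DecisionRule A₂ Z₂ τ) :
    G.V o (Function.update β₁ τ b₁) (Function.update β₂ τ b₂) = G.V o β₁ β₂ :=
  G.V_congr o (fun _ ht => Function.update_of_ne (Nat.ne_of_gt ht) _ _)
    (fun _ ht => Function.update_of_ne (Nat.ne_of_gt ht) _ _)

theorem IsNES.update {G : ZSPOSG S A₁ A₂ Z₁ Z₂} {τ : ℕ} {o : Occupancy S A₁ A₂ Z₁ Z₂ (τ + 1)}
    {β₁ : Strategy A₁ Z₁} {β₂ : Strategy A₂ Z₂} (h : G.IsNES o β₁ β₂) (b₁ : DecisionRule A₁ Z₁ τ)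
    (b₂ : DecisionRule A₂ Z₂ τ) :
    G.IsNES o (Function.update β₁ τ b₁) (Function.update β₂ τ b₂) := by
  refine ⟨fun β => ?_, fun β => ?_⟩
  -- Updating the deviation `β` by its own rule leaves it unchanged, so only the opponent's
  -- irrelevant rule at `τ` is replaced.
  · have := G.V_update o β β₂ (β τ) b₂
    rw [Function.update_eq_self] at this
    rw [V_update, this]
    exact h.1 β
  · have := G.V_update o β₁ β b₁ (β τ)
    rw [Function.update_eq_self] at this
    rw [V_update, this]
    exact h.2 β

/-- An equilibrium of the subgame at `G.T o b₁ b₂`, preceded by `b₁` and `b₂`, is optimal among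
strategies with these first rules: the instant reward is then constant and `γ ≥ 0` preserves the
inequalities. -/
theorem isLocalGame_Qstar [Nonempty A₁] [Nonempty A₂] (G : ZSPOSG S A₁ A₂ Z₁ Z₂) {τ : ℕ}
    (hτ : τ < G.H) (o : Occupancy S A₁ A₂ Z₁ Z₂ τ) :
    IsLocalGame (fun β₁ : Strategy A₁ Z₁ => β₁ τ) (fun β₂ : Strategy A₂ Z₂ => β₂ τ) (G.V o)
      (G.Qstar o) := fun b₁ b₂ => by
  obtain ⟨β₁, β₂, h⟩ := G.exists_isNES (G.T o b₁ b₂)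
  have h' := h.update b₁ b₂
  refine ⟨_, _, Function.update_self τ b₁ β₁, Function.update_self τ b₂ β₂, ?_, ?_⟩
  · rintro β rfl
    rw [ZSPOSG.V_eq_reward_add G hτ, Function.update_self, Qstar, ← h'.V_eq_Vstar]
    exact add_le_add_right (mul_le_mul_of_nonneg_left (h'.1 β) G.γ_nonneg) _
  · rintro β rfl
    rw [ZSPOSG.V_eq_reward_add G hτ, Function.update_self, Qstar, ← h'.V_eq_Vstar]
    exact add_le_add_right (mul_le_mul_of_nonneg_left (h'.2 β) G.γ_nonneg) _

/-- Unless the future is worthless, an equilibrium of the subgame at `o` induces one in the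
next subgame that it reaches. -/
theorem IsNES.next {G : ZSPOSG S A₁ A₂ Z₁ Z₂} {τ : ℕ} (hτ : τ < G.H) (hγ : G.γ ≠ 0)
    {o : Occupancy S A₁ A₂ Z₁ Z₂ τ} {β₁ : Strategy A₁ Z₁} {β₂ : Strategy A₂ Z₂}
    (h : G.IsNES o β₁ β₂) : G.IsNES (G.T o (β₁ τ) (β₂ τ)) β₁ β₂ := by
  have hpos : 0 < G.γ := lt_of_le_of_ne G.γ_nonneg hγ.symm
  refine ⟨fun β => ?_, fun β => ?_⟩
  -- A deviation that keeps the first rule reaches the same next occupancy state, so the reward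
  -- cancels and the positive factor `γ` can be divided out.
  · have := h.1 (Function.update β τ (β₁ τ))
    have hu := G.V_update (G.T o (β₁ τ) (β₂ τ)) β β₂ (β₁ τ) (β₂ τ)
    rw [Function.update_eq_self] at hu
    rw [ZSPOSG.V_eq_reward_add G hτ, V_eq_reward_add G hτ, Function.update_self, hu] at this
    exact le_of_mul_le_mul_left (le_of_add_le_add_left this) hpos
  · have := h.2 (Function.update β τ (β₂ τ))
    have hu := G.V_update (G.T o (β₁ τ) (β₂ τ)) β₁ β (β₁ τ) (β₂ τ)
    rw [Function.update_eq_self] at hu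
    rw [ZSPOSG.V_eq_reward_add G hτ, V_eq_reward_add G hτ, Function.update_self, hu] at this
    exact le_of_mul_le_mul_left (le_of_add_le_add_left this) hpos

end ZSPOSG

/-! ### The theorem -/

theorem mainTheorem1 {S A₁ A₂ Z₁ Z₂ : Type*}
    [Fintype S] [Fintype A₁] [Fintype A₂] [Fintype Z₁] [Fintype Z₂] [Nonempty A₁] [Nonempty A₂]
    (G : ZSPOSG S A₁ A₂ Z₁ Z₂) (τ : ℕ) (hτ : τ < G.H) (o : Occupancy S A₁ A₂ Z₁ Z₂ τ) :
    -- the subgame at `o` has a Nash equilibrium, and `Vstar o` is the value of all of them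
    (∃ β₁ β₂, G.IsNES o β₁ β₂) ∧
    (∀ β₁ β₂, G.IsNES o β₁ β₂ → G.V o β₁ β₂ = G.Vstar o) ∧
    -- the maximin and minimax values of the local game are `Vstar o`
    IsMaximinValue (G.Qstar o) (G.Vstar o) ∧
    IsMinimaxValue (G.Qstar o) (G.Vstar o) ∧
    -- a maximin rule and a minimax rule form a Nash equilibrium of the local game, and they extend,
    -- by a Nash equilibrium of the next subgame, to a Nash equilibrium of the subgame at `o`
    (∀ b₁ b₂, IsMaximinChoice (G.Qstar o) b₁ → IsMinimaxChoice (G.Qstar o) b₂ →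
      IsNash (G.Qstar o) b₁ b₂ ∧
      ∃ β₁ β₂, β₁ τ = b₁ ∧ β₂ τ = b₂ ∧ G.IsNES (G.T o b₁ b₂) β₁ β₂ ∧ G.IsNES o β₁ β₂) ∧
    -- the first rules of every Nash equilibrium of the subgame at `o` are maximin and minimax
    (∀ β₁ β₂, G.IsNES o β₁ β₂ →
      IsMaximinChoice (G.Qstar o) (β₁ τ) ∧ IsMinimaxChoice (G.Qstar o) (β₂ τ)) := by
  obtain ⟨β₁, β₂, hβ⟩ := G.exists_isNES o
  have hL := G.isLocalGame_Qstar hτ o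
  have hN₁ := G.exists_isNash_fixed_left o
  have hN₂ : ∀ b, ∃ β₂ β₁, IsNash
      (fun (β₂ : {β₂ : Strategy A₂ Z₂ // β₂ τ = b}) β₁ => -G.V o β₁ β₂) β₂ β₁ := fun b => by
    obtain ⟨β₁, β₂, h⟩ := G.exists_isNash_fixed_right o b
    exact ⟨β₂, β₁, h.neg_swap⟩
  have hmax : IsMaximinValue (G.Qstar o) (G.Vstar o) :=
    hβ.V_eq_Vstar ▸ (hL.isMaximin hN₁ hβ).1
  have hmin' : IsMaximinValue (fun b₂ b₁ => -G.Qstar o b₁ b₂) (-G.Vstar o) :=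
    hβ.V_eq_Vstar ▸ (hL.neg_swap.isMaximin hN₂ (IsNash.neg_swap hβ)).1
  have hmin : IsMinimaxValue (G.Qstar o) (G.Vstar o) := by
    rw [← neg_neg (G.Vstar o)]
    exact isMaximinValue_neg_swap.1 hmin'
  refine ⟨⟨β₁, β₂, hβ⟩, fun _ _ h => h.V_eq_Vstar, hmax, hmin, fun b₁ b₂ h₁ h₂ => ⟨?_, ?_⟩,
    fun _ _ h => ⟨(hL.isMaximin hN₁ h).2,
      isMaximinChoice_neg_swap.1 (hL.neg_swap.isMaximin hN₂ (IsNash.neg_swap h)).2⟩⟩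
  · have hge := h₁.le hmax
    have hle : ∀ b, G.Qstar o b b₂ ≤ G.Vstar o := fun b =>
      neg_le_neg_iff.1 ((isMaximinChoice_neg_swap.2 h₂).le hmin' b)
    exact ⟨fun b => (hle b).trans (hge b₂), fun b => (hle b₁).trans (hge b)⟩
  -- Two strategies that guarantee the common value `G.Vstar o` from both sides form an equilibrium.
  · obtain ⟨β₁, rfl, hg₁⟩ := hL.exists_guarantee hN₁ hmax h₁
    obtain ⟨β₂, rfl, hg₂⟩ :=
      hL.neg_swap.exists_guarantee hN₂ hmin' (isMaximinChoice_neg_swap.2 h₂)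
    have hle : ∀ β, G.V o β β₂ ≤ G.Vstar o := fun β => neg_le_neg_iff.1 (hg₂ β)
    have hNES : G.IsNES o β₁ β₂ :=
      ⟨fun β => (hle β).trans (hg₁ β₂), fun β => (hle β₁).trans (hg₁ β)⟩
    -- For `γ = 0` the equilibrium at `o` says nothing about later play. Any equilibrium of the next
    -- subgame can then be appended, because the value at `o` is the instant reward alone.
    by_cases hγ : G.γ = 0
    · obtain ⟨β₁', β₂', h'⟩ := G.exists_isNES (G.T o (β₁ τ) (β₂ τ))
      refine ⟨_, _, Function.update_self τ (β₁ τ) β₁', Function.update_self τ (β₂ τ) β₂',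
        h'.update _ _, fun β => ?_, fun β => ?_⟩
      · simpa [ZSPOSG.V_eq_reward_add G hτ, hγ] using hNES.1 β
      · simpa [ZSPOSG.V_eq_reward_add G hτ, hγ] using hNES.2 β
    · exact ⟨β₁, β₂, rfl, rfl, hNES.next hτ hγ, hNES⟩
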